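/- For integers $p\ge 3$ and $n\ge 1$, let the Hanoi graph $H_p^n$ be the graph whose vertices are the $p^n$ configurations of the Tower of Hanoi puzzle with $n$ discs $d_1,\dots,d_n$ of increasing size and $p$ pegs, i.e. the functions $\tau$ assigning a peg to each disc, two configurations being adjacent if they differ by a single legal move: one disc $d_i$ is moved to a different peg, and no smaller disc $d_j$, $j<i$, lies on the peg it leaves or on the peg it goes to. For a finite graph $G=(V,E)$ with $|V|\ge 2$, let its (edge) expansion be $$h(G)=\min_{\emptyset\ne S\subseteq V,\ |S|\le |V|/2}\frac{|\partial S|}{|S|},\qquad \partial S=\{(u,v) : u\in S,\ v\in V\setminus S,\ \{u,v\}\in E\}.$$ **Theorem.** For every fixed $p\ge 3$, $h(H_p^n)=\Theta\bigl(((p-2)/p)^n\bigr)$. That is, for every $p\ge 3$ there are constants $c,C>0$, depending only on $p$, such that for all $n\ge 1$ $$c\left(\frac{p-2}{p}\right)^n\ \le\ h(H_p^n)\ \le\ C\left(\frac{p-2}{p}\right)^n .$$ -/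

import Mathlib

/-- Moving the disc `d` from peg `τ d` to peg `σ d` is a legal move of the Tower of Hanoi puzzle
leading from the configuration `τ` to the configuration `σ`. There are `n` discs, a smaller index
being a smaller disc, and `p` pegs; a configuration assigns to each disc its peg. The move is legal
if no smaller disc lies on the peg of `d` (so that `d` is on top) or on the target peg (so that `d`
is put on a larger disc or on an empty peg). -/
def IsHanoiMove {p n : ℕ} (d : Fin n) (τ σ : Fin n → Fin p) : Prop :=
  σ d ≠ τ d ∧ (∀ e, e ≠ d → σ e = τ e) ∧ ∀ e, e < d → τ e ≠ τ d ∧ τ e ≠ σ d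

instance {p n : ℕ} (d : Fin n) (τ σ : Fin n → Fin p) : Decidable (IsHanoiMove d τ σ) := by
  unfold IsHanoiMove
  infer_instance

theorem IsHanoiMove.symm {p n : ℕ} {d : Fin n} {τ σ : Fin n → Fin p}
    (h : IsHanoiMove d τ σ) : IsHanoiMove d σ τ := by
  obtain ⟨h1, h2, h3⟩ := h
  refine ⟨h1.symm, fun e he => (h2 e he).symm, fun e he => ?_⟩
  rw [h2 e he.ne]
  exact ⟨(h3 e he).2, (h3 e he).1⟩

/-- The Hanoi graph with `p` pegs and `n` discs: the vertices are the `p ^ n` configurations, and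
two of them are adjacent if a single legal move leads from one to the other. -/
def hanoiGraph (p n : ℕ) : SimpleGraph (Fin n → Fin p) where
  Adj τ σ := ∃ d, IsHanoiMove d τ σ
  symm := ⟨fun _ _ ⟨d, h⟩ => ⟨d, h.symm⟩⟩
  loopless := ⟨fun _ ⟨_, h⟩ => h.1 rfl⟩

instance (p n : ℕ) : DecidableRel (hanoiGraph p n).Adj := fun τ σ =>
  inferInstanceAs (Decidable (∃ d, IsHanoiMove d τ σ))

/-- The edge expansion `h(G) = min |∂S| / |S|` of a finite graph, over the nonempty vertex sets `S`
with `|S| ≤ |V| / 2`, where `∂S` is the set of the edges between `S` and its complement, each listed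
once, as the pair whose first entry is in `S`. The infimum is over a finite family, which is
nonempty as soon as `G` has at least two vertices, and is then a minimum. -/
noncomputable def SimpleGraph.edgeExpansion {V : Type*} [Fintype V] [DecidableEq V]
    (G : SimpleGraph V) [DecidableRel G.Adj] : ℝ :=
  ⨅ S : {S : Finset V // S.Nonempty ∧ 2 * S.card ≤ Fintype.card V},
    ((G.interedges S.1 S.1ᶜ).card : ℝ) / (S.1.card : ℝ)

/-! Write `p = q + 2`. The upper bound tests the configurations with the largest disc on a fixed
peg: that disc moves only when all others avoid two pegs. The lower bound is proved for vertex sets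
`T` covering the boundary of `S`, by induction on the number of discs. Forgetting the smallest disc
loses a factor `q` in `|T|` and changes `|S| / p` by at most `|T| / p`
(`hanoiGraph_exists_coversBoundary_pred`). The endpoints in `S` of the boundary edges form such a
`T`. -/

theorem IsHanoiMove.cons {p n : ℕ} {d : Fin n} {τ σ : Fin n → Fin p} (h : IsHanoiMove d τ σ)
    {s : Fin p} (hτ : s ≠ τ d) (hσ : s ≠ σ d) :
    IsHanoiMove (n := n + 1) d.succ (Fin.cons s τ) (Fin.cons s σ) := by
  obtain ⟨h1, h2, h3⟩ := h
  refine ⟨by simpa using h1, fun e he => ?_, fun e he => ?_⟩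
  · cases e using Fin.cases with
    | zero => simp
    | succ e => simpa using h2 e (fun h => he (by rw [h]))
  · cases e using Fin.cases with
    | zero => simpa using ⟨hτ, hσ⟩
    | succ e => simpa using h3 e (by simpa using he)

theorem hanoiGraph_adj_cons_of_ne {p n : ℕ} (τ : Fin n → Fin p) {s t : Fin p} (h : s ≠ t) :
    (hanoiGraph p (n + 1)).Adj (Fin.cons s τ) (Fin.cons t τ) := by
  refine ⟨0, by simpa using h.symm, fun e he => ?_, fun e he => absurd he (by simp)⟩
  cases e using Fin.cases with
  | zero => exact absurd rfl he
  | succ e => simp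

theorem card_eq_sum_cons {p n : ℕ} (S : Finset (Fin (n + 1) → Fin p)) :
    S.card = ∑ τ : Fin n → Fin p,
      (Finset.univ.filter fun s => (Fin.cons s τ : Fin (n + 1) → Fin p) ∈ S).card := by
  have h : S.card = ∑ x : Fin (n + 1) → Fin p, if x ∈ S then 1 else 0 := by simp
  rw [h, ← (Fin.consEquiv fun _ => Fin p).sum_comp, Fintype.sum_prod_type_right]
  simp only [Finset.card_filter]
  rfl

/-- A set of vertices meeting every edge between `S` and its complement. -/
def SimpleGraph.CoversBoundary {V : Type*} (G : SimpleGraph V) (S T : Finset V) : Prop :=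
  ∀ u v, G.Adj u v → u ∈ S → v ∉ S → u ∈ T ∨ v ∈ T

/-- Rounding a fractional cover of the boundary of `S`, given by the weights `t / q`. -/
theorem SimpleGraph.exists_coversBoundary_of_weight {V : Type*} [Fintype V] [DecidableEq V]
    (G : SimpleGraph V) (S : Finset V) (t : V → ℕ) {q : ℕ} (hq : 0 < q)
    (ht : ∀ u v, G.Adj u v → u ∈ S → v ∉ S → q ≤ t u + t v) :
    ∃ T, G.CoversBoundary S T ∧ q * T.card ≤ ∑ v, t v := by
  -- Threshold rounding, as the boundary edges form a bipartite graph: every `U k` with `k < q`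
  -- covers them, and each `v` lies in at most `t v` of these sets, so some `k` does as well as the
  -- average.
  let U : ℕ → Finset V := fun k =>
    Finset.univ.filter fun v => if v ∈ S then k < t v else q ≤ t v + k
  have hsum : ∑ k ∈ Finset.range q, (U k).card ≤ ∑ v, t v := by
    simp only [U, Finset.card_filter]
    rw [Finset.sum_comm]
    refine Finset.sum_le_sum fun v _ => ?_
    rw [← Finset.card_filter]
    by_cases hv : v ∈ S
    · simp only [hv, if_true]
      calc _ ≤ (Finset.range (t v)).card := Finset.card_le_card fun k hk => by
            simp at hk ⊢; omega
        _ = t v := by simp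
    · simp only [hv, if_false]
      calc _ ≤ (Finset.Ico (q - t v) q).card := Finset.card_le_card fun k hk => by
            simp at hk ⊢; omega
        _ ≤ t v := by rw [Nat.card_Ico]; omega
  obtain ⟨k, hk, hle⟩ := Finset.exists_le_of_sum_le (s := Finset.range q)
    (f := fun k => q * (U k).card) (g := fun _ => ∑ v, t v) ⟨0, by simpa using hq⟩ (by
      rw [← Finset.mul_sum]
      simpa using Nat.mul_le_mul_left q hsum)
  refine ⟨U k, fun u v huv hu hv => ?_, hle⟩
  have := ht u v huv hu hv
  simp only [U, Finset.mem_filter, Finset.mem_univ, true_and, hu, hv, if_true, if_false]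
  omega

/-- The positions of the smallest disc over a fixed `τ` form a clique, so off `T` each fiber lies
entirely inside or entirely outside `S`; `S'` collects the former. -/
theorem hanoiGraph_exists_coversBoundary_pred {q n : ℕ} (hq : 0 < q)
    {S T : Finset (Fin (n + 1) → Fin (q + 2))}
    (h : (hanoiGraph (q + 2) (n + 1)).CoversBoundary S T) :
    ∃ S' T' : Finset (Fin n → Fin (q + 2)), (hanoiGraph (q + 2) n).CoversBoundary S' T' ∧
      q * T'.card ≤ T.card ∧ S.card ≤ (q + 2) * S'.card + T.card ∧
      (q + 2) * S'.card ≤ S.card + T.card := by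
  classical
  let fiber : Finset (Fin (n + 1) → Fin (q + 2)) → (Fin n → Fin (q + 2)) → Finset (Fin (q + 2)) :=
    fun R τ => Finset.univ.filter fun s => (Fin.cons s τ : Fin (n + 1) → Fin (q + 2)) ∈ R
  have mem_fiber (R τ s) : s ∈ fiber R τ ↔ (Fin.cons s τ : Fin (n + 1) → Fin (q + 2)) ∈ R := by
    simp [fiber]
  let S' : Finset (Fin n → Fin (q + 2)) :=
    Finset.univ.filter fun τ => ∃ s, s ∈ fiber S τ ∧ s ∉ fiber T τ
  have hin (τ) (hτ : τ ∈ S') (s) (hs : s ∉ fiber T τ) : s ∈ fiber S τ := by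
    obtain ⟨r, hr, hrT⟩ := (Finset.mem_filter.1 hτ).2
    by_contra hsS
    have hne : r ≠ s := fun e => hsS (e ▸ hr)
    simp only [mem_fiber] at *
    exact (h _ _ (hanoiGraph_adj_cons_of_ne τ hne) hr hsS).elim hrT hs
  have hout (τ) (hτ : τ ∉ S') (s) (hs : s ∉ fiber T τ) : s ∉ fiber S τ := fun hsS =>
    hτ (Finset.mem_filter.2 ⟨Finset.mem_univ _, s, hsS, hs⟩)
  have hcard (R : Finset (Fin (n + 1) → Fin (q + 2))) : R.card = ∑ τ, (fiber R τ).card :=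
    card_eq_sum_cons R
  have hS' : (q + 2) * S'.card = ∑ τ, if τ ∈ S' then q + 2 else 0 := by
    simp [mul_comm]
  obtain ⟨T', hT', hle⟩ := (hanoiGraph (q + 2) n).exists_coversBoundary_of_weight S'
    (fun τ => (fiber T τ).card) hq (by
      rintro τ σ ⟨d, hd⟩ hτ hσ
      -- The move of `d` lifts whenever the smallest disc is on one of the `q` other pegs, and each
      -- lift needs a vertex of `T`. Hence the fiber sizes over `q` form a fractional cover.
      have hsub : ({τ d, σ d} : Finset (Fin (q + 2)))ᶜ ⊆ fiber T τ ∪ fiber T σ := by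
        intro s hs
        simp only [Finset.mem_compl, Finset.mem_insert, Finset.mem_singleton, not_or] at hs
        by_contra hsT
        simp only [Finset.mem_union, not_or] at hsT
        have h1 := hin τ hτ s hsT.1
        have h2 := hout σ hσ s hsT.2
        simp only [mem_fiber] at *
        exact (h _ _ ⟨_, hd.cons hs.1 hs.2⟩ h1 h2).elim hsT.1 hsT.2
      have h1 := (Finset.card_le_card hsub).trans (Finset.card_union_le _ _)
      rw [Finset.card_compl, Finset.card_pair hd.1.symm, Fintype.card_fin] at h1
      simpa using h1)
  refine ⟨S', T', hT', by rwa [hcard T], ?_, ?_⟩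
  · rw [hS', hcard S, hcard T, ← Finset.sum_add_distrib]
    refine Finset.sum_le_sum fun τ _ => ?_
    split_ifs with hτ
    · exact (card_finset_fin_le _).trans (Nat.le_add_right _ _)
    · rw [zero_add]
      exact Finset.card_le_card fun s hs => by_contra fun hsT => hout τ hτ s hsT hs
  · rw [hS', hcard S, hcard T, ← Finset.sum_add_distrib]
    refine Finset.sum_le_sum fun τ _ => ?_
    split_ifs with hτ
    · have hsub : (Finset.univ : Finset (Fin (q + 2))) ⊆ fiber S τ ∪ fiber T τ := fun s _ => by
        by_cases hs : s ∈ fiber T τ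
        · exact Finset.mem_union_right _ hs
        · exact Finset.mem_union_left _ (hin τ hτ s hs)
      simpa using (Finset.card_le_card hsub).trans (Finset.card_union_le _ _)
    · exact Nat.zero_le _

/-- The vertex-isoperimetric inequality for Hanoi graphs. -/
theorem hanoiGraph_min_card_le {q : ℕ} (hq : 0 < q) (n : ℕ)
    (S T : Finset (Fin n → Fin (q + 2))) (h : (hanoiGraph (q + 2) n).CoversBoundary S T) :
    2 * (q : ℝ) ^ n * min (S.card : ℝ) (((q : ℝ) + 2) ^ n - S.card) ≤
      q * (((q : ℝ) + 2) ^ n - (q : ℝ) ^ n) * T.card := by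
  induction n with
  | zero =>
    have : S.card ≤ 1 := by simpa using S.card_le_univ
    interval_cases S.card <;> simp
  | succ n ih =>
    obtain ⟨S', T', h', hT, hS₁, hS₂⟩ := hanoiGraph_exists_coversBoundary_pred hq h
    have ih := ih S' T' h'
    have hT : (q : ℝ) * T'.card ≤ T.card := by exact_mod_cast hT
    have hS₁ : (S.card : ℝ) ≤ (q + 2) * S'.card + T.card := by exact_mod_cast hS₁
    have hS₂ : ((q : ℝ) + 2) * S'.card ≤ S.card + T.card := by exact_mod_cast hS₂
    -- The best factor `a n` in `min ≤ a n * |T|` thus obeys `a (n + 1) ≤ (q + 2) / q * a n + 1`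
    -- with `a 0 = 0`, which yields the stated coefficients.
    have hmin : min (S.card : ℝ) (((q : ℝ) + 2) ^ (n + 1) - S.card) ≤
        (q + 2) * min (S'.card : ℝ) (((q : ℝ) + 2) ^ n - S'.card) + T.card := by
      rw [mul_min_of_nonneg _ _ (by positivity), ← min_add_add_right]
      refine min_le_min hS₁ ?_
      rw [pow_succ]
      linarith
    have hpow : 0 ≤ ((q : ℝ) + 2) ^ n - (q : ℝ) ^ n :=
      sub_nonneg.2 (pow_le_pow_left₀ (by positivity) (by linarith) n)
    calc 2 * (q : ℝ) ^ (n + 1) * min (S.card : ℝ) (((q : ℝ) + 2) ^ (n + 1) - S.card)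
        ≤ 2 * (q : ℝ) ^ (n + 1) *
          ((q + 2) * min (S'.card : ℝ) (((q : ℝ) + 2) ^ n - S'.card) + T.card) := by gcongr
      _ = q * (q + 2) * (2 * (q : ℝ) ^ n * min (S'.card : ℝ) (((q : ℝ) + 2) ^ n - S'.card)) +
          2 * (q : ℝ) ^ (n + 1) * T.card := by ring
      _ ≤ q * (q + 2) * (q * (((q : ℝ) + 2) ^ n - (q : ℝ) ^ n) * T'.card) +
          2 * (q : ℝ) ^ (n + 1) * T.card := by gcongr
      _ = q * (q + 2) * (((q : ℝ) + 2) ^ n - (q : ℝ) ^ n) * (q * T'.card) +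
          2 * (q : ℝ) ^ (n + 1) * T.card := by ring
      _ ≤ q * (q + 2) * (((q : ℝ) + 2) ^ n - (q : ℝ) ^ n) * T.card +
          2 * (q : ℝ) ^ (n + 1) * T.card := by gcongr
      _ = q * (((q : ℝ) + 2) ^ (n + 1) - (q : ℝ) ^ (n + 1)) * T.card := by ring

theorem SimpleGraph.coversBoundary_image_fst_interedges {V : Type*} [Fintype V] [DecidableEq V]
    (G : SimpleGraph V) [DecidableRel G.Adj] (S : Finset V) :
    G.CoversBoundary S ((G.interedges S Sᶜ).image Prod.fst) := fun u v huv hu hv =>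
  Or.inl (Finset.mem_image.2 ⟨(u, v), by simp [SimpleGraph.mem_interedges_iff, hu, hv, huv], rfl⟩)

theorem hanoiGraph_le_card_interedges {q : ℕ} (hq : 0 < q) (n : ℕ)
    (S : Finset (Fin n → Fin (q + 2))) (hS : 2 * S.card ≤ (q + 2) ^ n) :
    2 / (q : ℝ) * ((q : ℝ) / (q + 2)) ^ n * S.card ≤
      ((hanoiGraph (q + 2) n).interedges S Sᶜ).card := by
  have h := hanoiGraph_min_card_le hq n S _
    ((hanoiGraph (q + 2) n).coversBoundary_image_fst_interedges S)
  have hS : 2 * (S.card : ℝ) ≤ ((q : ℝ) + 2) ^ n := by exact_mod_cast hS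
  rw [min_eq_left (by linarith)] at h
  have hT : ((((hanoiGraph (q + 2) n).interedges S Sᶜ).image Prod.fst).card : ℝ) ≤
      ((hanoiGraph (q + 2) n).interedges S Sᶜ).card := by exact_mod_cast Finset.card_image_le
  have hq : (0 : ℝ) < q := by exact_mod_cast hq
  have h2 : 2 * (q : ℝ) ^ n * S.card ≤
      q * ((q : ℝ) + 2) ^ n * ((hanoiGraph (q + 2) n).interedges S Sᶜ).card := by
    refine h.trans ?_
    gcongr
    linarith [pow_pos hq n]
  rw [div_pow, div_mul_div_comm, div_mul_eq_mul_div, div_le_iff₀ (by positivity)]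
  linarith

theorem exists_hanoiGraph_interedges_le {p : ℕ} (hp : 2 ≤ p) (m : ℕ) :
    ∃ S : Finset (Fin (m + 1) → Fin p), S.card = p ^ m ∧
      ((hanoiGraph p (m + 1)).interedges S Sᶜ).card ≤ (p - 2) ^ m * p := by
  let o : Fin p := ⟨0, by omega⟩
  let S : Finset (Fin (m + 1) → Fin p) :=
    Fintype.piFinset fun e => if e = Fin.last m then {o} else Finset.univ
  have mem_S (τ) : τ ∈ S ↔ τ (Fin.last m) = o := by
    simp only [S, Fintype.mem_piFinset]
    refine ⟨fun h => by simpa using h (Fin.last m), fun h e => ?_⟩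
    split_ifs with he
    · simp [he, h]
    · simp
  refine ⟨S, ?_, ?_⟩
  · simp [S, Fin.prod_univ_castSucc, Fin.castSucc_ne_last]
  · have key : ∀ x ∈ (hanoiGraph p (m + 1)).interedges S Sᶜ,
        IsHanoiMove (Fin.last m) x.1 x.2 ∧ x.1 (Fin.last m) = o := by
      rintro ⟨τ, σ⟩ hx
      simp only [SimpleGraph.mem_interedges_iff, Finset.mem_compl, mem_S] at hx
      obtain ⟨hτ, hσ, d, hd⟩ := hx
      have : d = Fin.last m := by
        by_contra hne
        exact hσ ((hd.2.1 _ (Ne.symm hne)).trans hτ)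
      exact ⟨this ▸ hd, hτ⟩
    have := Finset.card_le_mul_card_image_of_maps_to
      (s := (hanoiGraph p (m + 1)).interedges S Sᶜ) (t := Finset.univ)
      (f := fun x => x.2 (Fin.last m)) (fun _ _ => Finset.mem_univ _) ((p - 2) ^ m) ?_
    · simpa using this
    · intro j _
      by_cases hj : j = o
      · rw [Finset.filter_eq_empty_iff.2, Finset.card_empty]
        · exact Nat.zero_le _
        · intro x hx hxj
          have := key x hx
          exact this.1.1 (by rw [hxj, this.2, hj])
      · have hcard : (Fintype.piFinset fun _ : Fin m => ({o, j} : Finset (Fin p))ᶜ).card =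
            (p - 2) ^ m := by
          rw [Fintype.card_piFinset_const, Finset.card_compl, Finset.card_pair (Ne.symm hj),
            Fintype.card_fin]
        rw [← hcard]
        refine Finset.card_le_card_of_injOn (fun x e => x.1 e.castSucc) ?_ ?_
        · intro x hx
          simp only [Finset.coe_filter, Set.mem_ofPred_eq] at hx
          obtain ⟨hmove, ho⟩ := key x hx.1
          simp only [Finset.mem_coe, Fintype.mem_piFinset, Finset.mem_compl, Finset.mem_insert,
            Finset.mem_singleton, not_or]
          intro e
          have := hmove.2.2 _ (Fin.castSucc_lt_last e)
          rwa [ho, hx.2] at this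
        · intro x hx y hy hxy
          simp only [Finset.coe_filter, Set.mem_ofPred_eq] at hx hy
          obtain ⟨hx1, hx2⟩ := key x hx.1
          obtain ⟨hy1, hy2⟩ := key y hy.1
          have h1 : x.1 = y.1 := by
            funext e
            cases e using Fin.lastCases with
            | last => rw [hx2, hy2]
            | cast e => exact congrFun hxy e
          refine Prod.ext h1 (funext fun e => ?_)
          by_cases he : e = Fin.last m
          · rw [he, hx.2, hy.2]
          · rw [hx1.2.1 e he, hy1.2.1 e he, h1]

theorem theorem1 (p : ℕ) (hp : 3 ≤ p) :
    ∃ c C : ℝ, 0 < c ∧ 0 < C ∧ ∀ n : ℕ, 1 ≤ n →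
      c * (((p : ℝ) - 2) / (p : ℝ)) ^ n ≤ (hanoiGraph p n).edgeExpansion ∧
      (hanoiGraph p n).edgeExpansion ≤ C * (((p : ℝ) - 2) / (p : ℝ)) ^ n := by
  obtain ⟨q, rfl⟩ : ∃ q, p = q + 2 := ⟨p - 2, by omega⟩
  have hq : 0 < q := by omega
  have hq' : (0 : ℝ) < q := by exact_mod_cast hq
  -- The test set has ratio at most `p * (q / p) ^ m` with `m = n - 1`; shifting the exponent to `n`
  -- costs `p / q`.
  refine ⟨2 / q, (q + 2) ^ 2 / q, by positivity, by positivity, fun n hn => ?_⟩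
  obtain ⟨m, rfl⟩ : ∃ m, n = m + 1 := ⟨n - 1, by omega⟩
  obtain ⟨S, hS, hle⟩ := exists_hanoiGraph_interedges_le (p := q + 2) (by omega) m
  have hmem : S.Nonempty ∧ 2 * S.card ≤ Fintype.card (Fin (m + 1) → Fin (q + 2)) := by
    refine ⟨Finset.card_pos.1 (by rw [hS]; positivity), ?_⟩
    rw [hS, Fintype.card_pi_const, Fintype.card_fin, pow_succ, mul_comm]
    exact Nat.mul_le_mul_left _ (by omega)
  have hcast : ((q + 2 : ℕ) : ℝ) - 2 = q := by push_cast; ring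
  rw [hcast]
  push_cast
  constructor
  · have : Nonempty {S : Finset (Fin (m + 1) → Fin (q + 2)) //
        S.Nonempty ∧ 2 * S.card ≤ Fintype.card (Fin (m + 1) → Fin (q + 2))} := ⟨⟨S, hmem⟩⟩
    refine le_ciInf fun R => ?_
    rw [le_div_iff₀ (by exact_mod_cast R.2.1.card_pos)]
    exact hanoiGraph_le_card_interedges hq _ R.1 (by simpa using R.2.2)
  · refine (ciInf_le ⟨0, ?_⟩ ⟨S, hmem⟩).trans ?_
    · rintro _ ⟨R, rfl⟩
      positivity
    · have hle : (((hanoiGraph (q + 2) (m + 1)).interedges S Sᶜ).card : ℝ) ≤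
          (q : ℝ) ^ m * (q + 2) := by exact_mod_cast hle
      rw [hS, div_le_iff₀ (by positivity)]
      refine hle.trans (le_of_eq ?_)
      push_cast
      rw [div_pow]
      field_simp
      ring
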